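/- Let $n \ge 3$ and $a \ge 3$ be integers, let $S = \mathbb{C}[x_1,\dots,x_n]$, and let $$h_a = \sum_{1 \le i_1 \le i_2 \le \cdots \le i_a \le n} x_{i_1} x_{i_2} \cdots x_{i_a} \in S$$ be the complete homogeneous symmetric polynomial of degree $a$. Call a homogeneous polynomial $F \in S$ of positive degree smooth if the projective hypersurface $\{F = 0\} \subset \mathbb{P}^{n-1}$ has no singular point, that is, if $F, \frac{\partial F}{\partial x_1}, \dots, \frac{\partial F}{\partial x_n}$ have no common zero in $\mathbb{C}^n \setminus \{0\}$. Then for every $i \in \{1,\dots,n\}$ the partial derivative $\frac{\partial h_a}{\partial x_i}$ is a homogeneous polynomial of positive degree that is smooth, and hence it is irreducible in $S$. -/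

import Mathlib

/-- `p` is a singular zero of `F`: the polynomial `F` and all its first order partial derivatives
vanish at `p`. -/
def IsSingularZero {n : ℕ} (F : MvPolynomial (Fin n) ℂ) (p : Fin n → ℂ) : Prop :=
  MvPolynomial.eval p F = 0 ∧ ∀ j : Fin n, MvPolynomial.eval p (MvPolynomial.pderiv j F) = 0

/-- A polynomial `F` in `ℂ[x₁, …, xₙ]` is smooth if it is homogeneous of some positive degree and
the hypersurface `F = 0` in the projective space of lines in `ℂⁿ` has no singular point, that is,
`F` and its first order partial derivatives have no common zero in `ℂⁿ` other than the origin. -/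
def IsSmoothForm {n : ℕ} (F : MvPolynomial (Fin n) ℂ) : Prop :=
  (∃ d : ℕ, 0 < d ∧ F.IsHomogeneous d) ∧ ∀ p : Fin n → ℂ, p ≠ 0 → ¬ IsSingularZero F p

namespace MvPolynomial

/-! At a point `p`, the series `B = ∑ (∂ᵢh_{d+1})(p) t^d` is `1/E` with `E = (1 - pᵢt) ∏ⱼ (1 -
pⱼt)`, and `(∂ⱼ∂ᵢh_{e+2})(p)` is 1 or 2 times the `t^e` coefficient of `B/(1 - pⱼt)`. If these
vanish for all `j`, every `1 - pⱼt` divides the truncation `b` of `B` to degree at most `e`;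
`eq_zero_of_prod_one_sub_mul_eq` then forces `p = 0`. For irreducibility, nonunit factors `G`, `H`
of a form vanish at 0; for `n ≥ 3` they share a nonzero zero, where `GH` is singular. -/

lemma pderiv_pderiv_comm {σ R : Type*} [CommSemiring R] (i j : σ) (f : MvPolynomial σ R) :
    pderiv i (pderiv j f) = pderiv j (pderiv i f) := by
  rcases eq_or_ne i j with rfl | h
  · rfl
  · ext m
    simp only [coeff_pderiv, Finsupp.add_apply, Finsupp.single_eq_of_ne h,
      Finsupp.single_eq_of_ne h.symm, add_right_comm m (Finsupp.single i 1)]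
    push_cast
    ring

/-! ### Recurrences for derivatives of `hsymm` -/

section CompleteHomogeneous

variable {σ R : Type*} [Fintype σ] [DecidableEq σ] [CommRing R]

lemma hsymm_eq_sum_finsuppAntidiag (d : ℕ) :
    hsymm σ R d = ∑ m ∈ Finset.finsuppAntidiag Finset.univ d, monomial m 1 := by
  rw [hsymm]
  refine Finset.sum_bij (fun s _ => Multiset.toFinsupp s.1) ?_ ?_ ?_ ?_
  · intro s _
    simp only [Finset.mem_finsuppAntidiag, Finset.subset_univ, and_true]
    refine Eq.trans ?_ ((Multiset.toFinsupp_sum_eq s.1).trans s.2)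
    rw [Finsupp.sum_fintype _ _ (by simp)]
    rfl
  · intro s _ t _ h
    exact Subtype.ext (Multiset.toFinsupp.injective h)
  · intro m hm
    refine ⟨⟨Finsupp.toMultiset m, ?_⟩, Finset.mem_univ _, by simp⟩
    rw [Finset.mem_finsuppAntidiag] at hm
    rw [Finsupp.card_toMultiset, Finsupp.sum_fintype _ _ (by simp)]
    exact hm.1
  · intro s _
    rw [monomial_eq, Finsupp.prod_fintype _ _ (by simp), Finset.prod_multiset_map_count]
    simp only [map_one, one_mul, Multiset.toFinsupp_apply]
    refine Finset.prod_subset (Finset.subset_univ _) fun i _ hi => ?_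
    rw [Multiset.count_eq_zero.2 (by simpa using hi), pow_zero]

lemma coeff_hsymm (d : ℕ) (m : σ →₀ ℕ) :
    coeff m (hsymm σ R d) = if m.degree = d then 1 else 0 := by
  rw [hsymm_eq_sum_finsuppAntidiag, coeff_sum]
  simp [coeff_monomial, Finset.mem_finsuppAntidiag, Finsupp.degree_eq_sum]

lemma eval_hsymm_eq_coeff_prod (p : σ → R) (d : ℕ) :
    eval p (hsymm σ R d) =
      PowerSeries.coeff d (∏ i, PowerSeries.mk fun k => p i ^ k) := by
  rw [hsymm_eq_sum_finsuppAntidiag, map_sum, PowerSeries.coeff_prod]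
  refine Finset.sum_congr rfl fun m _ => ?_
  simp [eval_monomial, Finsupp.prod_fintype]

lemma isHomogeneous_pderiv_hsymm (i : σ) (d : ℕ) :
    (pderiv i (hsymm σ R (d + 1))).IsHomogeneous d := by
  intro m hm
  rw [coeff_pderiv, coeff_hsymm] at hm
  have h : (m + Finsupp.single i 1).degree = d + 1 := by
    by_contra h
    exact hm (by rw [if_neg h, zero_mul])
  rw [map_add, Finsupp.degree_single] at h
  rw [show Finsupp.weight (1 : σ → ℕ) m = m.degree from
    (DFunLike.congr_fun Finsupp.degree_eq_weight_one m).symm]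
  exact Nat.succ_injective h

/-- Coefficient form of `(1 - xᵢt) ∂ᵢH = tH` for `H = ∑ h_d t^d`. -/
lemma pderiv_hsymm_succ (i : σ) (d : ℕ) :
    pderiv i (hsymm σ R (d + 1)) = X i * pderiv i (hsymm σ R d) + hsymm σ R d := by
  ext m
  rw [coeff_add, coeff_X_mul', coeff_pderiv, coeff_hsymm, coeff_hsymm]
  have hdeg : (m + Finsupp.single i 1).degree = d + 1 ↔ m.degree = d := by
    rw [map_add, Finsupp.degree_single, Nat.add_right_cancel_iff]
  simp only [hdeg]
  split_ifs with hd hi hi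
  · have hle : Finsupp.single i 1 ≤ m := by
      rw [Finsupp.single_le_iff]
      exact Nat.one_le_iff_ne_zero.2 (Finsupp.mem_support_iff.1 hi)
    rw [coeff_pderiv, tsub_add_cancel_of_le hle, coeff_hsymm, if_pos hd]
    have h1 : 1 ≤ m i := by simpa using hle i
    simp only [Finsupp.tsub_apply, Finsupp.single_eq_same]
    push_cast [h1]
    ring
  · simp [Finsupp.notMem_support_iff.1 hi]
  · have hle : Finsupp.single i 1 ≤ m := by
      rw [Finsupp.single_le_iff]
      exact Nat.one_le_iff_ne_zero.2 (Finsupp.mem_support_iff.1 hi)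
    rw [coeff_pderiv, tsub_add_cancel_of_le hle, coeff_hsymm, if_neg hd]
    ring
  · ring

lemma pderiv_pderiv_hsymm_succ (i j : σ) (d : ℕ) :
    pderiv j (pderiv i (hsymm σ R (d + 1))) =
      X j * pderiv j (pderiv i (hsymm σ R d)) +
        (if i = j then 2 else 1) * pderiv i (hsymm σ R d) := by
  rw [pderiv_pderiv_comm, pderiv_hsymm_succ, map_add, pderiv_mul, pderiv_pderiv_comm i j]
  split_ifs with h
  · subst h
    rw [pderiv_X_self]
    ring
  · rw [pderiv_X_of_ne (Ne.symm h)]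
    ring

end CompleteHomogeneous

end MvPolynomial

/-! ### The one-variable divisibility argument -/

section

open Polynomial

variable {ι K : Type*} [Fintype ι] [Field K]

lemma Polynomial.prod_dvd_derivative_prod_mul (f : ι → K[X]) (g : K[X]) (h : ∀ j, f j ∣ g) :
    (∏ j, f j) ∣ derivative (∏ j, f j) * g := by
  classical
  rw [derivative_prod_finset, Finset.sum_mul]
  refine Finset.dvd_sum fun j _ => ?_
  rw [← Finset.mul_prod_erase Finset.univ f (Finset.mem_univ j)]
  obtain ⟨c, hc⟩ := h j
  rw [hc]
  exact ⟨derivative (f j) * c, by ring⟩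

/-- Differentiating `Eb` shows that `E` divides `X^e V`, hence `V = (e+1)r + Xr'`. In characteristic
0, `r ≠ 0` gives `V ≠ 0`, so `deg E ≤ deg r`, against `e + 1 + deg r = deg(Eb) ≤ deg E + e`. So `r =
0` and `E` is a unit. -/
theorem eq_zero_of_prod_one_sub_mul_eq [CharZero K] (y : ι → K) (e : ℕ) (b r : K[X])
    (hb : b.natDegree ≤ e) (hr : (∏ j, (1 - C (y j) * X)) * b = 1 + X ^ (e + 1) * r)
    (hdvd : ∀ j, (1 - C (y j) * X) ∣ b) : ∀ j, y j = 0 := by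
  set E : K[X] := ∏ j, (1 - C (y j) * X) with hE
  set V : K[X] := C ((e : K) + 1) * r + X * derivative r with hV
  have hcop : IsCoprime E (X ^ e) := by
    refine IsCoprime.pow_right ?_
    refine IsCoprime.prod_left fun j _ => ⟨1, C (y j), by ring⟩
  have hder : derivative (E * b) = X ^ e * V := by
    rw [hr, hV]
    simp only [derivative_one, derivative_mul, derivative_X_pow,
      Nat.cast_add, Nat.cast_one, add_tsub_cancel_right, map_add, map_natCast, map_one]
    ring
  have hEV : E ∣ V := by
    refine hcop.dvd_of_dvd_mul_left ?_
    rw [← hder, derivative_mul]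
    exact dvd_add (prod_dvd_derivative_prod_mul _ _ hdvd) (dvd_mul_right _ _)
  have hcoeff : ∀ k, V.coeff k = ((e : K) + 1 + k) * r.coeff k := by
    intro k
    rw [hV, coeff_add, coeff_C_mul]
    cases k with
    | zero => simp
    | succ k => rw [coeff_X_mul, coeff_derivative]; push_cast; ring
  have hpos : ∀ k : ℕ, (e : K) + 1 + k ≠ 0 := fun k => by
    exact_mod_cast (by omega : e + 1 + k ≠ 0)
  have hr0 : r = 0 := by
    by_contra hr0
    have hV0 : V ≠ 0 := fun h => hr0 <| by
      ext k
      have := hcoeff k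
      rw [h, coeff_zero] at this
      simpa [hpos k] using this.symm
    have hVr : V.natDegree ≤ r.natDegree := by
      refine natDegree_le_iff_coeff_eq_zero.2 fun k hk => ?_
      rw [hcoeff, coeff_eq_zero_of_natDegree_lt hk, mul_zero]
    have h1 : (X ^ (e + 1) * r).natDegree = e + 1 + r.natDegree := by
      rw [natDegree_mul (pow_ne_zero _ X_ne_zero) hr0, natDegree_X_pow]
    have h2 : (1 + X ^ (e + 1) * r).natDegree = e + 1 + r.natDegree := by
      rw [natDegree_add_eq_right_of_natDegree_lt (by rw [natDegree_one]; omega), h1]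
    have h3 := natDegree_mul_le (p := E) (q := b)
    have h4 := natDegree_le_of_dvd hEV hV0
    rw [hr] at h3
    omega
  intro j
  have hu : IsUnit (1 - C (y j) * X) := by
    refine isUnit_of_dvd_one ((Finset.dvd_prod_of_mem (fun j => 1 - C (y j) * X)
      (Finset.mem_univ j)).trans ?_)
    exact ⟨b, by rw [← hE, hr, hr0]; ring⟩
  by_contra hj
  have h5 := (isUnit_iff_coeff_isUnit_isNilpotent.1 hu).2 1 one_ne_zero
  simp [coeff_one, hj] at h5

end

namespace MvPolynomial

/-! ### Common zeros and factors of forms -/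

section

variable {K : Type*} [Field K] {n : ℕ}

lemma three_le_height_vanishingIdeal_zero (hn : 3 ≤ n) :
    3 ≤ (vanishingIdeal K {(0 : Fin n → K)} : Ideal (MvPolynomial (Fin n) K)).height := by
  -- `φ k` kills the first `k` variables; the kernels form a strict chain of primes.
  let φ : ℕ → MvPolynomial (Fin n) K →ₐ[K] MvPolynomial (Fin n) K := fun k =>
    aeval fun j => if j.val < k then 0 else X j
  let P : ℕ → Ideal (MvPolynomial (Fin n) K) := fun k => RingHom.ker (φ k)
  have hprime : ∀ k, (P k).IsPrime := fun k => RingHom.ker_isPrime _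
  have hcomp : ∀ k, (φ (k + 1)).comp (φ k) = φ (k + 1) := fun k => by
    ext j : 1
    by_cases h : j.val < k
    · simp [φ, h, h.le]
    · simp [φ, h]
  have hlt : ∀ k, k < n → P k < P (k + 1) := fun k hk => by
    refine lt_of_le_of_ne (fun f hf => ?_) fun h => ?_
    · rw [RingHom.mem_ker] at hf ⊢
      rw [← hcomp k]
      simp only [AlgHom.comp_apply] at hf ⊢
      rw [hf, map_zero]
    · have h1 : (X ⟨k, hk⟩ : MvPolynomial (Fin n) K) ∈ P (k + 1) := by
        simp [P, RingHom.mem_ker, φ]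
      rw [← h] at h1
      simp [P, RingHom.mem_ker, φ] at h1
  have hheight : ∀ k ≤ n, (k : ℕ∞) ≤ (P k).height := fun k => by
    induction k with
    | zero => simp
    | succ k ih =>
      intro hk
      have := hprime k
      have := hprime (k + 1)
      push_cast
      exact (add_le_add_left (ih (by omega)) 1).trans
        (Ideal.height_add_one_le_of_lt_of_isPrime (hlt k (by omega)))
  refine (hheight 3 hn).trans (Ideal.height_mono fun f hf => ?_)
  rw [mem_vanishingIdeal_singleton_iff]
  have h0 : (aeval (0 : Fin n → K)).comp (φ 3) = aeval (0 : Fin n → K) := by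
    ext j
    simp only [φ, AlgHom.comp_apply, aeval_X]
    split_ifs <;> simp
  have hf' : φ 3 f = 0 := hf
  rw [← h0, AlgHom.comp_apply, hf', map_zero]

theorem exists_ne_zero_common_zero [IsAlgClosed K] (hn : 3 ≤ n) (G H : MvPolynomial (Fin n) K)
    (hG : eval 0 G = 0) (hH : eval 0 H = 0) :
    ∃ p : Fin n → K, p ≠ 0 ∧ eval p G = 0 ∧ eval p H = 0 := by
  classical
  by_contra! hcon
  set m : Ideal (MvPolynomial (Fin n) K) := vanishingIdeal K {(0 : Fin n → K)} with hm
  set I : Ideal (MvPolynomial (Fin n) K) := Ideal.span (({G, H} : Finset _) : Set _) with hI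
  have hIm : I ≤ m := by
    rw [hI, Ideal.span_le]
    intro f hf
    simp only [Finset.coe_insert, Finset.coe_singleton, Set.mem_insert_iff,
      Set.mem_singleton_iff] at hf
    rcases hf with rfl | rfl <;>
      simpa only [SetLike.mem_coe, hm, mem_vanishingIdeal_singleton_iff, aeval_eq_eval]
  have hzero : zeroLocus K I ⊆ {0} := fun p hp => by
    by_contra hp0
    have h1 : eval p G = 0 := by
      simpa [aeval_eq_eval] using hp G (Ideal.subset_span (by simp))
    have h2 : eval p H = 0 := by
      simpa [aeval_eq_eval] using hp H (Ideal.subset_span (by simp))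
    exact hcon p hp0 h1 h2
  have hmrad : m ≤ I.radical := by
    rw [← vanishingIdeal_zeroLocus_eq_radical (K := K)]
    exact vanishingIdeal_anti_mono hzero
  have hmin : m ∈ I.minimalPrimes :=
    ⟨⟨inferInstance, hIm⟩, fun q hq _ => hmrad.trans (hq.1.radical_le_iff.2 hq.2)⟩
  -- Krull's height theorem: two generators allow height at most 2.
  have h1 := Ideal.height_le_card_of_mem_minimalPrimes_span_finset hmin
  have h2 := three_le_height_vanishingIdeal_zero (K := K) hn
  have h3 : (3 : ℕ∞) ≤ (2 : ℕ) :=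
    h2.trans (h1.trans (Nat.cast_le.2 Finset.card_le_two))
  norm_cast at h3

end

section

variable {σ K : Type*} [Field K]

/-- Restriction of a polynomial to the line through the origin spanned by `p`. -/
noncomputable def lineRestriction (p : σ → K) : MvPolynomial σ K →ₐ[K] Polynomial K :=
  aeval fun j => Polynomial.C (p j) * Polynomial.X

lemma eval_lineRestriction (p : σ → K) (t : K) (f : MvPolynomial σ K) :
    (lineRestriction p f).eval t = eval (fun j => p j * t) f := by
  have h : (Polynomial.aeval t).comp (lineRestriction p) = aeval fun j => p j * t := by
    ext j
    simp [lineRestriction]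
  simpa [Polynomial.coe_aeval_eq_eval, aeval_eq_eval] using DFunLike.congr_fun h f

lemma IsHomogeneous.lineRestriction {f : MvPolynomial σ K} {d : ℕ} (hf : f.IsHomogeneous d)
    (p : σ → K) : lineRestriction p f = Polynomial.C (eval p f) * Polynomial.X ^ d := by
  rw [MvPolynomial.lineRestriction, aeval_def, eval₂_eq, eval_eq, map_sum, Finset.sum_mul]
  refine Finset.sum_congr rfl fun m hm => ?_
  rw [hf.degree_eq_sum_deg_support hm, ← Finset.prod_pow_eq_pow_sum]
  simp [mul_pow, Finset.prod_mul_distrib, mul_assoc]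

/-- On a line where `GH = ct^d`, `c ≠ 0`, a factor with `G(0) ≠ 0` is prime to `t`, hence constant.
So `GH(G - G(0))` vanishes everywhere. -/
lemma eval_zero_eq_zero_of_isHomogeneous_mul [Infinite K] {G H : MvPolynomial σ K} {d : ℕ}
    (hGH : (G * H).IsHomogeneous d) (h0 : G * H ≠ 0) (hG : ¬ IsUnit G) : eval 0 G = 0 := by
  by_contra hG0
  refine hG ?_
  have key : ∀ p : σ → K, eval p (G * H) ≠ 0 → eval p G = eval 0 G := fun p hp => by
    set g := MvPolynomial.lineRestriction p G with hg
    have hg0 : g.eval 0 = eval 0 G := by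
      rw [hg, eval_lineRestriction]; congr 1; simp [Pi.zero_def]
    have hcop : IsCoprime g (Polynomial.X ^ d) := by
      refine IsCoprime.pow_right (IsCoprime.symm ?_)
      rw [Polynomial.irreducible_X.coprime_iff_not_dvd, Polynomial.X_dvd_iff,
        Polynomial.coeff_zero_eq_eval_zero, hg0]
      exact hG0
    have hdvd : g ∣ Polynomial.C (eval p (G * H)) * Polynomial.X ^ d := by
      rw [← hGH.lineRestriction p, map_mul]
      exact dvd_mul_right _ _
    have hu : IsUnit g := isUnit_of_dvd_unit (hcop.dvd_of_dvd_mul_right hdvd)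
      (Polynomial.isUnit_C.2 (isUnit_iff_ne_zero.2 hp))
    obtain ⟨c, -, hc⟩ := Polynomial.isUnit_iff.1 hu
    have hg1 : g.eval 1 = eval p G := by
      rw [hg, eval_lineRestriction]; simp
    rw [← hg1, ← hg0, ← hc, Polynomial.eval_C, Polynomial.eval_C]
  have hmul : (G * H) * (G - C (eval 0 G)) = 0 := by
    refine MvPolynomial.funext fun p => ?_
    rw [map_mul, map_sub, eval_C, map_zero, mul_eq_zero, sub_eq_zero, or_iff_not_imp_left]
    exact key p
  have hGC : G = C (eval 0 G) := sub_eq_zero.1 ((mul_eq_zero.1 hmul).resolve_left h0)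
  rw [hGC]
  exact (isUnit_iff_ne_zero.2 hG0).map C

end
end MvPolynomial

namespace MvPolynomial

/-! ### Generating series and smoothness -/

section Evaluation

variable {σ R : Type*} [Fintype σ] [DecidableEq σ] [CommRing R]

lemma prod_one_sub_mul_mk_eval_hsymm (p : σ → R) :
    (∏ j, (1 - PowerSeries.C (p j) * PowerSeries.X)) *
      PowerSeries.mk (fun d => eval p (hsymm σ R d)) = 1 := by
  have h : PowerSeries.mk (fun d => eval p (hsymm σ R d)) =
      ∏ i, PowerSeries.mk fun k => p i ^ k := by
    ext d
    rw [PowerSeries.coeff_mk, eval_hsymm_eq_coeff_prod]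
  rw [h, ← Finset.prod_mul_distrib]
  refine Finset.prod_eq_one fun j _ => ?_
  ext d
  rw [sub_mul, one_mul, mul_assoc, map_sub, PowerSeries.coeff_C_mul]
  cases d with
  | zero => simp
  | succ d => simp [PowerSeries.coeff_succ_X_mul, pow_succ', PowerSeries.coeff_one]

lemma one_sub_mul_mk_eval_pderiv_hsymm (p : σ → R) (i : σ) :
    (1 - PowerSeries.C (p i) * PowerSeries.X) *
      PowerSeries.mk (fun d => eval p (pderiv i (hsymm σ R (d + 1)))) =
      PowerSeries.mk (fun d => eval p (hsymm σ R d)) := by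
  ext d
  rw [sub_mul, one_mul, mul_assoc, map_sub, PowerSeries.coeff_C_mul]
  cases d with
  | zero => simp
  | succ d =>
    rw [PowerSeries.coeff_succ_X_mul]
    simp [pderiv_hsymm_succ i (d + 1)]

end Evaluation

section Smooth

open Polynomial in
theorem eq_zero_of_eval_pderiv_pderiv_hsymm_eq_zero {σ K : Type*} [Fintype σ] [DecidableEq σ]
    [Field K] [CharZero K] (i : σ) (e : ℕ) (p : σ → K)
    (h : ∀ j, eval p (pderiv j (pderiv i (hsymm σ K (e + 2)))) = 0) : p = 0 := by
  set B : PowerSeries K := PowerSeries.mk fun d => eval p (pderiv i (hsymm σ K (d + 1))) with hB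
  -- The extra index `none` doubles the factor of `pᵢ`.
  set y : Option σ → K := fun o => o.elim (p i) p with hy
  set E : K[X] := ∏ o, (1 - Polynomial.C (y o) * Polynomial.X) with hE
  set b : K[X] := PowerSeries.trunc (e + 1) B with hb
  have hEB : (E : PowerSeries K) * B = 1 := by
    have h1 := one_sub_mul_mk_eval_pderiv_hsymm p i
    have h2 := prod_one_sub_mul_mk_eval_hsymm p
    rw [← h1, ← hB] at h2
    rw [← h2, hE, ← Polynomial.coeToPowerSeries.ringHom_apply, map_prod, Fintype.prod_option]
    simp [hy]
    ring
  have hdvd : (Polynomial.X : K[X]) ^ (e + 1) ∣ E * b - 1 := by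
    rw [Polynomial.X_pow_dvd_iff]
    intro d hd
    rw [Polynomial.coeff_sub, ← PowerSeries.trunc_one (R := K) e, ← hEB,
      ← PowerSeries.trunc_mul_trunc, ← hb, PowerSeries.coeff_trunc, if_pos hd,
      ← Polynomial.coe_mul, Polynomial.coeff_coe, sub_self]
  obtain ⟨r, hr⟩ := hdvd
  have hj : ∀ j, 1 - Polynomial.C (p j) * Polynomial.X ∣ b := fun j => by
    set s : K := if i = j then 2 else 1 with hs
    have hs0 : s ≠ 0 := by rw [hs]; split_ifs <;> norm_num
    have hrec : ∀ d, eval p (pderiv j (pderiv i (hsymm σ K (d + 1)))) =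
        p j * eval p (pderiv j (pderiv i (hsymm σ K d))) +
          s * eval p (pderiv i (hsymm σ K d)) := fun d => by
      rw [pderiv_pderiv_hsymm_succ, map_add, map_mul, map_mul, eval_X, hs]
      split_ifs <;> simp
    set c : K[X] := PowerSeries.trunc e
      (PowerSeries.mk fun d => s⁻¹ * eval p (pderiv j (pderiv i (hsymm σ K (d + 2))))) with hc
    refine ⟨c, ?_⟩
    have hjj := h j
    ext d
    rw [hb, hc, sub_mul, one_mul, mul_assoc, Polynomial.coeff_sub, Polynomial.coeff_C_mul]
    cases d with
    | zero =>
      have h1 : eval p (pderiv j (pderiv i (hsymm σ K 2))) =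
          s * eval p (pderiv i (hsymm σ K 1)) := by
        rw [hrec 1, hrec 0]
        simp
      rw [Polynomial.coeff_X_mul_zero, mul_zero, sub_zero]
      simp only [PowerSeries.coeff_trunc, PowerSeries.coeff_mk, hB]
      rw [if_pos e.succ_pos, zero_add, zero_add, h1, inv_mul_cancel_left₀ hs0]
      split_ifs with he
      · rfl
      · obtain rfl : e = 0 := by omega
        rw [zero_add, h1] at hjj
        exact (mul_eq_zero.1 hjj).resolve_left hs0
    | succ d =>
      rw [Polynomial.coeff_X_mul]
      simp only [PowerSeries.coeff_trunc, PowerSeries.coeff_mk, hB]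
      have h1 := hrec (d + 2)
      rcases lt_trichotomy (d + 1) e with hde | rfl | hde
      · rw [if_pos (by omega), if_pos hde, if_pos (by omega), show d + 1 + 2 = d + 2 + 1 from rfl,
          h1, show d + 1 + 1 = d + 2 from rfl]
        field_simp
        ring
      -- In top degree `e` the cofactor `c` contributes only through its shift; the vanishing
      -- hypothesis closes the gap.
      · rw [if_pos (by omega), if_neg (by omega), if_pos (by omega),
          show d + 1 + 1 = d + 2 from rfl]
        rw [show d + 1 + 2 = d + 2 + 1 from rfl, h1] at hjj
        field_simp
        linear_combination hjj
      · rw [if_neg (by omega), if_neg (by omega), if_neg (by omega), mul_zero, sub_zero]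
  have hall := eq_zero_of_prod_one_sub_mul_eq y e b r
    (Nat.lt_succ_iff.1 (PowerSeries.natDegree_trunc_lt B e))
    (by rw [← hr]; ring) (fun o => by cases o with
      | none => exact hj i
      | some j => exact hj j)
  exact _root_.funext fun j => hall (some j)

end Smooth

end MvPolynomial

open MvPolynomial in
theorem IsSmoothForm.irreducible {n : ℕ} (hn : 3 ≤ n) {F : MvPolynomial (Fin n) ℂ}
    (hF : IsSmoothForm F) : Irreducible F := by
  obtain ⟨⟨d, hd, hhom⟩, hsm⟩ := hF
  have hF0 : F ≠ 0 := by
    rintro rfl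
    have : Nonempty (Fin n) := ⟨⟨0, by omega⟩⟩
    exact hsm 1 one_ne_zero (by simp [IsSingularZero])
  refine ⟨fun hu => ?_, fun G H hGH => ?_⟩
  · have h1 := hhom.totalDegree hF0
    rw [(isUnit_iff_totalDegree_of_isReduced.1 hu).2] at h1
    omega
  · by_contra! hcon
    subst hGH
    have hG := eval_zero_eq_zero_of_isHomogeneous_mul hhom hF0 hcon.1
    have hH := eval_zero_eq_zero_of_isHomogeneous_mul (G := H) (H := G)
      (by rwa [mul_comm]) (by rwa [mul_comm]) hcon.2
    obtain ⟨p, hp, hpG, hpH⟩ := exists_ne_zero_common_zero hn G H hG hH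
    exact hsm p hp ⟨by simp [hpG], fun j => by simp [hpG, hpH]⟩

theorem mainTheorem10 (n a : ℕ) (hn : 3 ≤ n) (ha : 3 ≤ a) (i : Fin n) :
    IsSmoothForm (MvPolynomial.pderiv i (MvPolynomial.hsymm (Fin n) ℂ a)) ∧
      Irreducible (MvPolynomial.pderiv i (MvPolynomial.hsymm (Fin n) ℂ a)) := by
  obtain ⟨e, rfl⟩ : ∃ e, a = e + 2 := ⟨a - 2, by omega⟩
  have h : IsSmoothForm (MvPolynomial.pderiv i (MvPolynomial.hsymm (Fin n) ℂ (e + 2))) :=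
    ⟨⟨e + 1, e.succ_pos, MvPolynomial.isHomogeneous_pderiv_hsymm i (e + 1)⟩, fun p hp hs =>
      hp (MvPolynomial.eq_zero_of_eval_pderiv_pderiv_hsymm_eq_zero i e p hs.2)⟩
  exact ⟨h, h.irreducible hn⟩
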